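/- All C*-algebras are unital, and morphisms are unital $*$-homomorphisms. For a C*-algebra $A$ let $\mathcal S(A)$ be its state space (positive linear functionals $\sigma$ with $\sigma(1)=1$), endowed with the weak* topology, and let $\otimes$ denote the spatial tensor product of C*-algebras. Let $A$ be a nonzero C*-algebra and let $(C,\phi,\nu)$ be a random quantum map on $A$, that is, $C$ is a C*-algebra, $\phi\colon A\to A\otimes C$ is a morphism and $\nu\in\mathcal S(C)$. For $\sigma\in\mathcal S(A)$ let $\sigma\otimes\nu$ denote the product state on $A\otimes C$, i.e. the unique continuous linear functional with $(\sigma\otimes\nu)(a\otimes c)=\sigma(a)\nu(c)$. Then the set of invariant states $$\mathcal I_{\phi,\nu}(A)=\{\sigma\in\mathcal S(A) : (\sigma\otimes\nu)\circ\phi=\sigma\}$$ is a nonempty, weak*-closed, convex subset of $\mathcal S(A)$. -/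

import Mathlib

open scoped ComplexOrder TensorProduct InnerProductSpace ENNReal

noncomputable section

namespace RandomQuantum

universe u v w

/-! ## States -/

/-- The state space `S(A)` of a unital C*-algebra `A`: the positive functionals `σ` with
`σ 1 = 1`, inside the dual of `A` with its weak* topology. -/
def stateSpace (A : Type u) [CStarAlgebra A] [PartialOrder A] : Set (WeakDual ℂ A) :=
  {σ | (∀ a : A, 0 ≤ a → 0 ≤ σ a) ∧ σ 1 = 1}

section Universal

variable (A : Type u) [CStarAlgebra A] [PartialOrder A]

/-- A state, as a bundled positive linear functional. -/
def stateSpace.toPositive {A : Type u} [CStarAlgebra A] [PartialOrder A] [StarOrderedRing A]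
    (σ : stateSpace A) :
    A →ₚ[ℂ] ℂ :=
  PositiveLinearMap.mk₀ (σ : WeakDual ℂ A).toLinearMap σ.2.1

@[simp]
lemma stateSpace.toPositive_apply {A : Type u} [CStarAlgebra A] [PartialOrder A]
    [StarOrderedRing A] (σ : stateSpace A) (a : A) : stateSpace.toPositive σ a = (σ : WeakDual ℂ A) a := rfl

variable [StarOrderedRing A]

/-! ## The universal representation -/

/-- The Hilbert space of the universal representation of `A`: the Hilbert sum, over all the
states of `A`, of the GNS Hilbert spaces. -/
def UniversalSpace : Type u :=
  lp (fun σ : stateSpace A => (stateSpace.toPositive σ).GNS) 2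

instance : NormedAddCommGroup (UniversalSpace A) :=
  inferInstanceAs (NormedAddCommGroup
    (lp (fun σ : stateSpace A => (stateSpace.toPositive σ).GNS) 2))

instance : InnerProductSpace ℂ (UniversalSpace A) :=
  inferInstanceAs (InnerProductSpace ℂ
    (lp (fun σ : stateSpace A => (stateSpace.toPositive σ).GNS) 2))

instance : CompleteSpace (UniversalSpace A) :=
  inferInstanceAs (CompleteSpace
    (lp (fun σ : stateSpace A => (stateSpace.toPositive σ).GNS) 2))

variable {A}

/-- Every GNS representation is contractive. -/
lemma norm_gns_le (σ : stateSpace A) (a : A) :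
    ‖(stateSpace.toPositive σ).gnsStarAlgHom a‖ ≤ ‖a‖ :=
  NonUnitalStarAlgHom.norm_apply_le _ a

variable (A)

/-- The direct sum of the GNS representations of all the states of `A`. -/
def lpRep : A →⋆ₐ[ℂ] (lp (fun σ : stateSpace A => (stateSpace.toPositive σ).GNS) 2 →L[ℂ]
    lp (fun σ : stateSpace A => (stateSpace.toPositive σ).GNS) 2) where
  toFun a := lp.mapCLM 2 (fun σ => (stateSpace.toPositive σ).gnsStarAlgHom a) (norm_nonneg a)
    (fun σ => norm_gns_le σ a)
  map_one' := by
    ext x σ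
    simp [-PositiveLinearMap.gnsStarAlgHom_apply]
  map_mul' a b := by
    ext x σ
    simp [-PositiveLinearMap.gnsStarAlgHom_apply]
  map_zero' := by
    ext x σ
    simp [-PositiveLinearMap.gnsStarAlgHom_apply]
  map_add' a b := by
    ext x σ
    simp [-PositiveLinearMap.gnsStarAlgHom_apply]
  commutes' r := by
    ext x σ
    simp [-PositiveLinearMap.gnsStarAlgHom_apply, Algebra.algebraMap_eq_smul_one]
  map_star' a := by
    rw [ContinuousLinearMap.star_eq_adjoint]
    refine (ContinuousLinearMap.eq_adjoint_iff _ _).mpr fun x y => ?_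
    simp only [lp.inner_eq_tsum]
    refine tsum_congr fun σ => ?_
    simp [-PositiveLinearMap.gnsStarAlgHom_apply, map_star,
      ContinuousLinearMap.star_eq_adjoint, ContinuousLinearMap.adjoint_inner_left]

lemma lpRep_apply (a : A) (x : lp (fun σ : stateSpace A => (stateSpace.toPositive σ).GNS) 2)
    (σ : stateSpace A) :
    (lpRep A a x) σ = (stateSpace.toPositive σ).gnsStarAlgHom a (x σ) := rfl

/-- The universal representation of `A`: the direct sum of the GNS representations of all the
states of `A`. -/
def universalRep : A →⋆ₐ[ℂ] (UniversalSpace A →L[ℂ] UniversalSpace A) := lpRep A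

open Classical in
/-- The unit vector of the universal representation which implements the state `σ`: the class
of `1` in the summand of `σ`. -/
def stateVector {A : Type u} [CStarAlgebra A] [PartialOrder A] [StarOrderedRing A]
    (σ : stateSpace A) : UniversalSpace A :=
  (lp.single 2 σ (((stateSpace.toPositive σ).toPreGNS 1 : (stateSpace.toPositive σ).PreGNS) :
    (stateSpace.toPositive σ).GNS) :
      lp (fun σ : stateSpace A => (stateSpace.toPositive σ).GNS) 2)

lemma inner_stateVector {A : Type u} [CStarAlgebra A] [PartialOrder A] [StarOrderedRing A]
    (σ : stateSpace A) (a : A) :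
    ⟪stateVector σ, universalRep A a (stateVector σ)⟫_ℂ = (σ : WeakDual ℂ A) a := by
  classical
  refine (lp.inner_eq_tsum (𝕜 := ℂ)
    (G := fun σ : stateSpace A => (stateSpace.toPositive σ).GNS) _ _).trans ?_
  rw [tsum_eq_single σ]
  · refine (congrArg (inner ℂ _) (lpRep_apply A a _ σ)).trans ?_
    simp [stateVector, PositiveLinearMap.preGNS_inner_def]
  · intro τ hτ
    simp [stateVector, hτ]

end Universal

/-! ## The Hilbert space tensor product -/

section HilbertTensor

/-- The functional `S ↦ ⟪v, S v⟫` on the bounded operators of a Hilbert space. -/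
def vectorFunctional {H : Type u} [NormedAddCommGroup H] [InnerProductSpace ℂ H] (v : H) :
    (H →L[ℂ] H) →L[ℂ] ℂ :=
  (innerSL ℂ v) ∘L (ContinuousLinearMap.apply ℂ H v)

/-- The Hilbert space tensor product: the completion of the algebraic tensor product for the
inner product with `⟪x ⊗ y, x' ⊗ y'⟫ = ⟪x, x'⟫ * ⟪y, y'⟫`. -/
def HilbertTensor (H : Type u) (K : Type v) [NormedAddCommGroup H] [InnerProductSpace ℂ H]
    [NormedAddCommGroup K] [InnerProductSpace ℂ K] : Type (max u v) :=
  UniformSpace.Completion (H ⊗[ℂ] K)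

variable {H : Type u} {K : Type v} [NormedAddCommGroup H] [InnerProductSpace ℂ H]
  [NormedAddCommGroup K] [InnerProductSpace ℂ K]

instance : NormedAddCommGroup (HilbertTensor H K) :=
  inferInstanceAs (NormedAddCommGroup (UniformSpace.Completion (H ⊗[ℂ] K)))

instance : InnerProductSpace ℂ (HilbertTensor H K) :=
  inferInstanceAs (InnerProductSpace ℂ (UniformSpace.Completion (H ⊗[ℂ] K)))

instance : CompleteSpace (HilbertTensor H K) :=
  inferInstanceAs (CompleteSpace (UniformSpace.Completion (H ⊗[ℂ] K)))

/-- The inclusion of the algebraic tensor product. -/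
def HilbertTensor.ofTensor (x : H ⊗[ℂ] K) : HilbertTensor H K :=
  (x : UniformSpace.Completion (H ⊗[ℂ] K))

lemma HilbertTensor.inner_ofTensor (x y : H ⊗[ℂ] K) :
    ⟪HilbertTensor.ofTensor x, HilbertTensor.ofTensor y⟫_ℂ = ⟪x, y⟫_ℂ :=
  UniformSpace.Completion.inner_coe x y

lemma HilbertTensor.induction_on {p : HilbertTensor H K → Prop} (x : HilbertTensor H K)
    (hp : IsClosed {x | p x}) (ih : ∀ x : H ⊗[ℂ] K, p (HilbertTensor.ofTensor x)) : p x :=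
  UniformSpace.Completion.induction_on x hp ih

/-- The operator `S ⊗ T` on the Hilbert space tensor product. -/
def opTensor (S : H →L[ℂ] H) (T : K →L[ℂ] K) : HilbertTensor H K →L[ℂ] HilbertTensor H K :=
  (TensorProduct.mapL S T).completion

lemma opTensor_ofTensor (S : H →L[ℂ] H) (T : K →L[ℂ] K) (x : H ⊗[ℂ] K) :
    opTensor S T (HilbertTensor.ofTensor x) =
      HilbertTensor.ofTensor (TensorProduct.mapL S T x) :=
  ContinuousLinearMap.completion_apply_coe (TensorProduct.mapL S T) x

lemma opTensor_mul (S S' : H →L[ℂ] H) (T T' : K →L[ℂ] K) :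
    opTensor S T * opTensor S' T' = opTensor (S * S') (T * T') := by
  ext x
  induction x using HilbertTensor.induction_on with
  | hp => exact isClosed_eq (by fun_prop) (by fun_prop)
  | ih x => rw [mul_apply_eq_comp, opTensor_ofTensor, opTensor_ofTensor,
      opTensor_ofTensor, TensorProduct.mapL_mul, mul_apply_eq_comp]

lemma opTensor_one : opTensor (1 : H →L[ℂ] H) (1 : K →L[ℂ] K) = 1 := by
  ext x
  induction x using HilbertTensor.induction_on with
  | hp => exact isClosed_eq (by fun_prop) (by fun_prop)
  | ih x =>
    rw [opTensor_ofTensor, ContinuousLinearMap.one_def, ContinuousLinearMap.one_def,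
      TensorProduct.mapL_id_id]
    rfl

lemma opTensor_star [CompleteSpace H] [CompleteSpace K] (S : H →L[ℂ] H) (T : K →L[ℂ] K) :
    star (opTensor S T) = opTensor (star S) (star T) := by
  rw [ContinuousLinearMap.star_eq_adjoint, eq_comm]
  refine (ContinuousLinearMap.eq_adjoint_iff _ _).mpr fun x y => ?_
  induction x using HilbertTensor.induction_on with
  | hp => exact isClosed_eq (by fun_prop) (by fun_prop)
  | ih x =>
  induction y using HilbertTensor.induction_on with
  | hp => exact isClosed_eq (by fun_prop) (by fun_prop)
  | ih y =>
  rw [opTensor_ofTensor, opTensor_ofTensor, HilbertTensor.inner_ofTensor,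
    HilbertTensor.inner_ofTensor]
  induction x with
  | zero => simp
  | add x x' hx hx' => simp only [map_add, inner_add_left, hx, hx']
  | tmul x x' =>
    induction y with
    | zero => simp
    | add y y' hy hy' => simp only [map_add, inner_add_right, hy, hy']
    | tmul y y' =>
      simp [ContinuousLinearMap.star_eq_adjoint, ContinuousLinearMap.adjoint_inner_left]

end HilbertTensor

/-! ## The spatial tensor product -/

section Tensor

variable (A : Type u) [CStarAlgebra A] [PartialOrder A] [StarOrderedRing A]
  (C : Type v) [CStarAlgebra C] [PartialOrder C] [StarOrderedRing C]

/-- The Hilbert space tensor product of the spaces of the universal representations of `A`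
and `C`. -/
abbrev TensorSpace := HilbertTensor (UniversalSpace A) (UniversalSpace C)

variable {A C}

/-- For `a` in `A` and `c` in `C`, the operator `π a ⊗ ρ c` on the Hilbert space tensor product,
where `π` and `ρ` are the universal representations of `A` and `C`. -/
def tensorOp (a : A) (c : C) : TensorSpace A C →L[ℂ] TensorSpace A C :=
  opTensor (universalRep A a) (universalRep C c)

lemma tensorOp_mul (a a' : A) (c c' : C) :
    tensorOp a c * tensorOp a' c' = tensorOp (a * a') (c * c') := by
  simp only [tensorOp, opTensor_mul, map_mul]

lemma tensorOp_one : tensorOp (1 : A) (1 : C) = 1 := by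
  simp only [tensorOp, map_one, opTensor_one]

lemma tensorOp_star (a : A) (c : C) : star (tensorOp a c) = tensorOp (star a) (star c) := by
  simp only [tensorOp, opTensor_star, map_star]

variable (A C)

/-- The spatial tensor product `A ⊗ C`: the C*-algebra of operators on the Hilbert space tensor
product generated by the operators `π a ⊗ ρ c`, where `π` and `ρ` are the (faithful) universal
representations of `A` and `C`. -/
def spatialTensor : StarSubalgebra ℂ (TensorSpace A C →L[ℂ] TensorSpace A C) :=
  (StarAlgebra.adjoin ℂ {x | ∃ (a : A) (c : C), x = tensorOp a c}).topologicalClosure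

/-- The spatial tensor product, as a type. -/
def SpatialTensor := spatialTensor A C

instance : CStarAlgebra (SpatialTensor A C) :=
  StarSubalgebra.cstarAlgebra (spatialTensor A C)
    (h_closed := StarSubalgebra.isClosed_topologicalClosure _)

/-- The inclusion of the spatial tensor product in the algebra of all bounded operators. -/
def SpatialTensor.toOp : SpatialTensor A C →⋆ₐ[ℂ] (TensorSpace A C →L[ℂ] TensorSpace A C) :=
  (spatialTensor A C).subtype

/-- The inclusion of the spatial tensor product, as a continuous linear map. -/
def SpatialTensor.toOpL : SpatialTensor A C →L[ℂ] (TensorSpace A C →L[ℂ] TensorSpace A C) where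
  toLinearMap := (SpatialTensor.toOp A C).toAlgHom.toLinearMap
  cont := continuous_subtype_val

variable {A C}

lemma SpatialTensor.isometry_toOp : Isometry (SpatialTensor.toOp A C) :=
  isometry_subtype_coe

/-- The elementary tensor `a ⊗ c` in `A ⊗ C`. -/
def tmul (a : A) (c : C) : SpatialTensor A C :=
  ⟨tensorOp a c, StarSubalgebra.le_topologicalClosure _
    (StarAlgebra.subset_adjoin ℂ _ ⟨a, c, rfl⟩)⟩

lemma SpatialTensor.toOp_tmul (a : A) (c : C) :
    SpatialTensor.toOp A C (tmul a c) = tensorOp a c := rfl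

lemma SpatialTensor.toOp_mem (x : SpatialTensor A C) :
    SpatialTensor.toOp A C x ∈ spatialTensor A C := Subtype.prop x

lemma tmul_mul (a a' : A) (c c' : C) : tmul a c * tmul a' c' = tmul (a * a') (c * c') :=
  SpatialTensor.isometry_toOp.injective <| by
    simp only [map_mul, SpatialTensor.toOp_tmul, tensorOp_mul]

lemma tmul_one_one : tmul (1 : A) (1 : C) = 1 :=
  SpatialTensor.isometry_toOp.injective <| by
    simp only [map_one, SpatialTensor.toOp_tmul, tensorOp_one]

lemma tmul_star (a : A) (c : C) : star (tmul a c) = tmul (star a) (star c) :=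
  SpatialTensor.isometry_toOp.injective <| by
    simp only [map_star, SpatialTensor.toOp_tmul, tensorOp_star]

/-- The star algebra generated by the operators `π a ⊗ ρ c` is their linear span. -/
lemma mem_span_of_mem_adjoin {y : TensorSpace A C →L[ℂ] TensorSpace A C}
    (hy : y ∈ StarAlgebra.adjoin ℂ {x | ∃ (a : A) (c : C), x = tensorOp a c}) :
    y ∈ Submodule.span ℂ {x | ∃ (a : A) (c : C), x = tensorOp a c} := by
  refine StarAlgebra.adjoin_induction (p := fun z _ => z ∈ Submodule.span ℂ
    {x | ∃ (a : A) (c : C), x = tensorOp a c}) ?_ ?_ ?_ ?_ ?_ hy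
  · exact fun z hz => Submodule.subset_span hz
  · intro r
    rw [Algebra.algebraMap_eq_smul_one, ← tensorOp_one]
    exact Submodule.smul_mem _ _ (Submodule.subset_span ⟨1, 1, rfl⟩)
  · exact fun _ _ _ _ h h' => Submodule.add_mem _ h h'
  · intro z z' hz hz' h h'
    clear hz hz'
    induction h, h' using Submodule.span_induction₂ with
    | mem_mem z z' h h' =>
      obtain ⟨a, c, rfl⟩ := h
      obtain ⟨a', c', rfl⟩ := h'
      exact Submodule.subset_span ⟨_, _, tensorOp_mul a a' c c'⟩
    | zero_left => simp
    | zero_right => simp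
    | add_left _ _ _ _ _ _ h h' => rw [add_mul]; exact Submodule.add_mem _ h h'
    | add_right _ _ _ _ _ _ h h' => rw [mul_add]; exact Submodule.add_mem _ h h'
    | smul_left _ _ _ _ _ h => rw [smul_mul_assoc]; exact Submodule.smul_mem _ _ h
    | smul_right _ _ _ _ _ h => rw [mul_smul_comm]; exact Submodule.smul_mem _ _ h
  · intro z hz h
    clear hz
    induction h using Submodule.span_induction with
    | mem z h =>
      obtain ⟨a, c, rfl⟩ := h
      exact Submodule.subset_span ⟨_, _, tensorOp_star a c⟩
    | zero => simp
    | add _ _ _ _ h h' => rw [star_add]; exact Submodule.add_mem _ h h'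
    | smul _ _ _ h => rw [star_smul]; exact Submodule.smul_mem _ _ h

/-- The linear span of the elementary tensors is dense in the spatial tensor product. -/
lemma dense_span_tmul :
    Dense (Submodule.span ℂ {x : SpatialTensor A C | ∃ a c, x = tmul a c} :
      Set (SpatialTensor A C)) := by
  intro x
  rw [SpatialTensor.isometry_toOp.isUniformInducing.isInducing.closure_eq_preimage_closure_image]
  have hx : SpatialTensor.toOp A C x ∈ ((StarAlgebra.adjoin ℂ
      {x | ∃ (a : A) (c : C), x = tensorOp a c}).topologicalClosure :
        Set (TensorSpace A C →L[ℂ] TensorSpace A C)) := SpatialTensor.toOp_mem x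
  rw [StarSubalgebra.topologicalClosure_coe] at hx
  refine closure_mono ?_ hx
  intro y hy
  have hy' := mem_span_of_mem_adjoin hy
  clear hy hx
  induction hy' using Submodule.span_induction with
  | mem z h =>
    obtain ⟨a, c, rfl⟩ := h
    exact ⟨tmul a c, Submodule.subset_span ⟨a, c, rfl⟩, rfl⟩
  | zero => exact ⟨0, Submodule.zero_mem _, map_zero _⟩
  | add _ _ _ _ h h' =>
    obtain ⟨z, hz, rfl⟩ := h
    obtain ⟨z', hz', rfl⟩ := h'
    exact ⟨z + z', Submodule.add_mem _ hz hz', map_add _ _ _⟩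
  | smul r _ _ h =>
    obtain ⟨z, hz, rfl⟩ := h
    exact ⟨r • z, Submodule.smul_mem _ _ hz, map_smul _ _ _⟩

/-! ## Product states -/

/-- The unit vector `ξ_σ ⊗ ξ_ν`. -/
def productVector (σ : stateSpace A) (ν : stateSpace C) : TensorSpace A C :=
  HilbertTensor.ofTensor (stateVector σ ⊗ₜ[ℂ] stateVector ν)

/-- The product state `σ ⊗ ν` on `A ⊗ C`, as the vector state of `ξ_σ ⊗ ξ_ν`. By
`productState_tmul` and `eq_productState`, it is the only continuous linear functional on `A ⊗ C`
that maps `a ⊗ c` to `σ a * ν c`. -/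
def productState (σ : stateSpace A) (ν : stateSpace C) : SpatialTensor A C →L[ℂ] ℂ :=
  (vectorFunctional (productVector σ ν)) ∘L (SpatialTensor.toOpL A C)

lemma productState_apply (σ : stateSpace A) (ν : stateSpace C) (x : SpatialTensor A C) :
    productState σ ν x =
      ⟪productVector σ ν, SpatialTensor.toOp A C x (productVector σ ν)⟫_ℂ := rfl

/-- `(σ ⊗ ν) (a ⊗ c) = σ a * ν c`. -/
lemma productState_tmul (σ : stateSpace A) (ν : stateSpace C) (a : A) (c : C) :
    productState σ ν (tmul a c) = (σ : WeakDual ℂ A) a * (ν : WeakDual ℂ C) c := by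
  rw [productState_apply, SpatialTensor.toOp_tmul]
  unfold tensorOp productVector
  rw [opTensor_ofTensor, HilbertTensor.inner_ofTensor, TensorProduct.mapL_tmul,
    TensorProduct.inner_tmul, inner_stateVector, inner_stateVector]

/-- The product state is determined by its values on the elementary tensors. -/
lemma eq_productState (σ : stateSpace A) (ν : stateSpace C) (ω : SpatialTensor A C →L[ℂ] ℂ)
    (h : ∀ a c, ω (tmul a c) = (σ : WeakDual ℂ A) a * (ν : WeakDual ℂ C) c) :
    ω = productState σ ν := by
  refine ContinuousLinearMap.ext_on dense_span_tmul ?_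
  rintro _ ⟨a, c, rfl⟩
  exact (h a c).trans (productState_tmul σ ν a c).symm

lemma productState_star_mul_self_nonneg (σ : stateSpace A) (ν : stateSpace C)
    (x : SpatialTensor A C) : 0 ≤ productState σ ν (star x * x) := by
  rw [productState_apply, map_mul, map_star, ContinuousLinearMap.star_eq_adjoint,
    mul_apply_eq_comp, ContinuousLinearMap.adjoint_inner_right, inner_self_eq_norm_sq_to_K]
  rw [← RCLike.ofReal_pow]
  exact RCLike.ofReal_nonneg.mpr (sq_nonneg _)

lemma productState_one (σ : stateSpace A) (ν : stateSpace C) :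
    productState σ ν (1 : SpatialTensor A C) = 1 := by
  rw [← tmul_one_one, productState_tmul, σ.2.2, ν.2.2, one_mul]

end Tensor

/-! ## Random quantum maps -/

section Maps

/-- A random quantum map `(C, φ, ν)` from `B` to `A`: a unital *-homomorphism `φ` from `B` to the
spatial tensor product `A ⊗ C`, and a state `ν` of `C`. -/
structure RandomQuantumMap (B : Type w) (A : Type u) (C : Type v)
    [CStarAlgebra B] [CStarAlgebra A] [PartialOrder A] [StarOrderedRing A]
    [CStarAlgebra C] [PartialOrder C] [StarOrderedRing C] where
  /-- The quantum family of maps. -/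
  φ : B →⋆ₐ[ℂ] SpatialTensor A C
  /-- The state on the parameter algebra. -/
  ν : stateSpace C

variable {B : Type w} {A : Type u} {C : Type v}
  [CStarAlgebra B] [CStarAlgebra A] [PartialOrder A] [StarOrderedRing A]
  [CStarAlgebra C] [PartialOrder C] [StarOrderedRing C]

/-- The continuous linear functional `(σ ⊗ ν) ∘ φ` on `B`. -/
def RandomQuantumMap.pullback (R : RandomQuantumMap B A C) (σ : stateSpace A) : WeakDual ℂ B :=
  StrongDual.toWeakDual
    { toFun := fun b => productState σ R.ν (R.φ b)
      map_add' := fun b b' => by rw [map_add, map_add]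
      map_smul' := fun r b => by rw [map_smul, map_smul, RingHom.id_apply]
      cont := (productState σ R.ν).continuous.comp
        (AddMonoidHomClass.continuous_of_bound R.φ 1 fun b => by
          rw [one_mul]; exact NonUnitalStarAlgHom.norm_apply_le R.φ b) }

lemma RandomQuantumMap.pullback_apply (R : RandomQuantumMap B A C) (σ : stateSpace A) (b : B) :
    R.pullback σ b = productState σ R.ν (R.φ b) := rfl

/-- The transition of a random quantum map on states: `σ ↦ (σ ⊗ ν) ∘ φ`. -/
def RandomQuantumMap.transition [PartialOrder B] [StarOrderedRing B]
    (R : RandomQuantumMap B A C) (σ : stateSpace A) : stateSpace B :=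
  ⟨R.pullback σ, by
    constructor
    · intro b hb
      obtain ⟨s, rfl⟩ := CStarAlgebra.nonneg_iff_eq_star_mul_self.mp hb
      rw [RandomQuantumMap.pullback_apply, map_mul, map_star]
      exact productState_star_mul_self_nonneg _ _ _
    · rw [RandomQuantumMap.pullback_apply, map_one]
      exact productState_one _ _⟩

lemma RandomQuantumMap.transition_apply [PartialOrder B] [StarOrderedRing B]
    (R : RandomQuantumMap B A C) (σ : stateSpace A) (b : B) :
    (R.transition σ : WeakDual ℂ B) b = productState σ R.ν (R.φ b) := rfl

/-- The set of invariant states of a random quantum map on `A`: the states `σ` such that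
`(σ ⊗ ν) ∘ φ = σ`. -/
def RandomQuantumMap.invariantStates (R : RandomQuantumMap A A C) : Set (WeakDual ℂ A) :=
  {σ | ∃ h : σ ∈ stateSpace A, R.transition ⟨σ, h⟩ = ⟨σ, h⟩}

end Maps

end RandomQuantum

end

/-! This is the Markov–Kakutani argument for the transition T σ = (σ ⊗ ν) ∘ φ. The state space is
convex, weak*-compact by Banach–Alaoglu (`isCompact_stateSpace`), and nonempty by Hahn–Banach
(`stateSpace_nonempty`). T is weak*-continuous: on elementary tensors (σ ⊗ ν)(a ⊗ c) = σ(a)ν(c) is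
continuous in σ, and density extends this to all of A ⊗ C because product states are contractive
(`continuous_productState`). T is affine because a product state is determined by its values on
elementary tensors (`transition_sum`). Hence the fixed points of T form a closed convex set. For the
averages m_n of the first n + 1 points of an orbit, T m_n - m_n telescopes to (T^(n+1) σ₀ - σ₀)/(n +
1), which tends to 0 at each element of A, so every cluster point of (m_n) is fixed. -/

open scoped ComplexOrder TensorProduct InnerProductSpace ENNReal

noncomputable section

namespace RandomQuantum

universe u v

/-! ### The state space: closed, convex, compact and nonempty. -/

section StateSpace

variable {A : Type u} [CStarAlgebra A]

/-- A functional of norm at most one with `f 1 = 1` takes real values on self-adjoint elements. -/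
lemma im_apply_eq_zero_of_norm_le_one {f : StrongDual ℂ A} (hf : ‖f‖ ≤ 1) (hf1 : f 1 = 1)
    {a : A} (ha : IsSelfAdjoint a) : (f a).im = 0 := by
  -- The C*-identity makes ‖a + it‖² grow like t² with no linear term, whereas |f a + it|² contains
  -- 2t Im (f a).
  have key (t : ℝ) : ‖f a + t * Complex.I‖ ^ 2 ≤ ‖a‖ ^ 2 + t ^ 2 := by
    have h1 : f (a + (t * Complex.I) • (1 : A)) = f a + t * Complex.I := by
      rw [map_add, map_smul, hf1, smul_eq_mul, mul_one]
    have h2 : star (a + (t * Complex.I) • (1 : A)) * (a + (t * Complex.I) • (1 : A)) =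
        a * a + ((t ^ 2 : ℝ) : ℂ) • (1 : A) := by
      have h3 : (t * Complex.I) * (t * Complex.I) = -((t ^ 2 : ℝ) : ℂ) := by
        push_cast
        linear_combination (t : ℂ) ^ 2 * Complex.I_mul_I
      have h5 : star (t * Complex.I) = -(t * Complex.I) := by simp
      simp only [star_add, star_smul, star_one, ha.star_eq, h5, add_mul, mul_add, smul_mul_assoc,
        one_mul, mul_smul_comm, mul_one, smul_add, smul_neg, smul_smul, neg_mul, neg_smul, h3,
        neg_neg]
      abel
    -- Only an inequality, since the zero algebra is allowed here.
    have h4 : ‖(1 : A)‖ ≤ 1 := by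
      rcases subsingleton_or_nontrivial A with h | h
      · simp [Subsingleton.elim (1 : A) 0]
      · exact CStarRing.norm_one.le
    calc ‖f a + t * Complex.I‖ ^ 2
        ≤ ‖a + (t * Complex.I) • (1 : A)‖ ^ 2 := by
          rw [← h1]
          gcongr
          simpa using f.le_of_opNorm_le hf (a + (t * Complex.I) • (1 : A))
      _ = ‖a * a + ((t ^ 2 : ℝ) : ℂ) • (1 : A)‖ := by
          rw [← h2, CStarRing.norm_star_mul_self, sq]
      _ ≤ ‖a * a‖ + ‖((t ^ 2 : ℝ) : ℂ) • (1 : A)‖ := norm_add_le _ _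
      _ ≤ ‖a‖ ^ 2 + t ^ 2 := by
          refine add_le_add ((norm_mul_le a a).trans_eq (sq _).symm) ?_
          rw [norm_smul, Complex.norm_real, Real.norm_of_nonneg (sq_nonneg t)]
          exact mul_le_of_le_one_right (sq_nonneg t) h4
  by_contra hy
  -- For this t the cross term 2t Im (f a) equals 2‖a‖², which exceeds the available ‖a‖².
  have h := key (‖a‖ ^ 2 / (f a).im)
  rw [Complex.sq_norm, Complex.normSq_apply] at h
  simp only [Complex.add_re, Complex.mul_re, Complex.ofReal_re, Complex.I_re, mul_zero,
    Complex.ofReal_im, Complex.I_im, mul_one, sub_self, add_zero, Complex.add_im, Complex.mul_im]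
    at h
  have h5 : ‖a‖ ^ 2 / (f a).im * (f a).im = ‖a‖ ^ 2 := div_mul_cancel₀ _ hy
  nlinarith [sq_nonneg (f a).re, sq_nonneg ‖a‖, sq_pos_of_ne_zero hy]

variable [PartialOrder A]

lemma isClosed_stateSpace : IsClosed (stateSpace A) := by
  have h : stateSpace A = (⋂ a : A, ⋂ _ : 0 ≤ a, {σ : WeakDual ℂ A | 0 ≤ σ a}) ∩ {σ | σ 1 = 1} := by
    ext σ
    simp [stateSpace]
  rw [h]
  exact (isClosed_iInter fun a => isClosed_iInter fun _ =>
    isClosed_le continuous_const (WeakDual.eval_continuous a)).inter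
      (isClosed_eq (WeakDual.eval_continuous 1) continuous_const)

lemma convex_stateSpace : Convex ℝ (stateSpace A) := by
  intro σ hσ τ hτ s t hs ht hst
  refine ⟨fun a ha => ?_, ?_⟩
  · change 0 ≤ s • σ a + t • τ a
    exact add_nonneg (smul_nonneg hs (hσ.1 a ha)) (smul_nonneg ht (hτ.1 a ha))
  · change s • σ 1 + t • τ 1 = 1
    rw [hσ.2, hτ.2, ← add_smul, hst, one_smul]

variable [StarOrderedRing A]

/-- A functional of norm at most one with `f 1 = 1` is positive. -/
lemma apply_nonneg_of_norm_le_one {f : StrongDual ℂ A} (hf : ‖f‖ ≤ 1) (hf1 : f 1 = 1)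
    {a : A} (ha : 0 ≤ a) : 0 ≤ f a := by
  refine Complex.nonneg_iff.mpr
    ⟨?_, (im_apply_eq_zero_of_norm_le_one hf hf1 (.of_nonneg ha)).symm⟩
  -- Since 0 ≤ ‖a‖·1 - a ≤ ‖a‖·1, the number f a lies in the disc of centre and radius ‖a‖, so its
  -- real part is nonnegative.
  have hle : a ≤ algebraMap ℝ A ‖a‖ := (IsSelfAdjoint.of_nonneg ha).le_algebraMap_norm_self
  have h1 : ‖algebraMap ℝ A ‖a‖ - a‖ ≤ ‖a‖ :=
    (CStarAlgebra.norm_le_iff_le_algebraMap _ (norm_nonneg a) (sub_nonneg.mpr hle)).mpr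
      (sub_le_self _ ha)
  have h2 : f (algebraMap ℝ A ‖a‖) = ‖a‖ := by
    have h3 : algebraMap ℝ A ‖a‖ = (‖a‖ : ℂ) • (1 : A) := by
      rw [Algebra.algebraMap_eq_smul_one, Complex.coe_smul]
    rw [h3, map_smul, hf1, smul_eq_mul, mul_one]
  have h4 : ‖(‖a‖ : ℂ) - f a‖ ≤ ‖a‖ := by
    rw [← h2, ← map_sub]
    exact (f.le_of_opNorm_le hf _).trans (by rwa [one_mul])
  have h5 := (Complex.re_le_norm _).trans h4
  rw [Complex.sub_re, Complex.ofReal_re] at h5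
  linarith

/-- Hahn–Banach gives a functional of norm one attaining the norm of 1 ≠ 0; such a functional is
positive. -/
lemma stateSpace_nonempty [Nontrivial A] : (stateSpace A).Nonempty := by
  have h1 : ‖(1 : A)‖ = 1 := CStarRing.norm_one
  obtain ⟨f, hf, hf1⟩ := exists_dual_vector ℂ (1 : A) (by simp [h1])
  replace hf1 : f 1 = 1 := by simpa [h1] using hf1
  exact ⟨StrongDual.toWeakDual f, fun a ha => apply_nonneg_of_norm_le_one hf.le hf1 ha, hf1⟩

lemma norm_stateVector (σ : stateSpace A) : ‖stateVector σ‖ = 1 := by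
  have h := inner_stateVector σ 1
  rw [map_one, one_apply_eq_self, σ.2.2, inner_self_eq_norm_sq_to_K] at h
  have h' : ‖stateVector σ‖ ^ 2 = 1 := Complex.ofReal_injective (by simpa using h)
  exact (pow_eq_one_iff_of_nonneg (norm_nonneg _) two_ne_zero).mp h'

/-- Cauchy–Schwarz for the unit vector that implements σ in the contractive universal
representation. -/
lemma norm_state_apply_le (σ : stateSpace A) (a : A) : ‖(σ : WeakDual ℂ A) a‖ ≤ ‖a‖ := by
  rw [← inner_stateVector σ a]
  calc _ ≤ ‖stateVector σ‖ * ‖universalRep A a (stateVector σ)‖ := norm_inner_le_norm _ _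
    _ ≤ 1 * (‖a‖ * 1) := by
      rw [norm_stateVector]
      gcongr
      exact ((universalRep A a).le_of_opNorm_le (NonUnitalStarAlgHom.norm_apply_le _ a) _).trans_eq
        (by rw [norm_stateVector])
    _ = ‖a‖ := by ring

lemma isCompact_stateSpace : IsCompact (stateSpace A) := by
  refine (WeakDual.isCompact_closedBall (𝕜 := ℂ) (E := A) 0 1).of_isClosed_subset
    isClosed_stateSpace fun σ hσ => ?_
  rw [Set.mem_preimage, mem_closedBall_zero_iff]
  exact ContinuousLinearMap.opNorm_le_bound _ zero_le_one fun a =>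
    (norm_state_apply_le ⟨σ, hσ⟩ a).trans_eq (one_mul _).symm

end StateSpace

/-! ### Continuity and affinity of the transition. -/

section Transition

variable {A : Type u} [CStarAlgebra A] [PartialOrder A] [StarOrderedRing A]
  {C : Type v} [CStarAlgebra C] [PartialOrder C] [StarOrderedRing C]

lemma norm_productState_apply_le (σ : stateSpace A) (ν : stateSpace C) (x : SpatialTensor A C) :
    ‖productState σ ν x‖ ≤ ‖x‖ := by
  have hv : ‖productVector σ ν‖ = 1 := by
    refine (UniformSpace.Completion.norm_coe (stateVector σ ⊗ₜ[ℂ] stateVector ν)).trans ?_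
    rw [TensorProduct.norm_tmul, norm_stateVector, norm_stateVector, one_mul]
  rw [productState_apply]
  calc _ ≤ ‖productVector σ ν‖ * ‖SpatialTensor.toOp A C x (productVector σ ν)‖ :=
        norm_inner_le_norm _ _
    _ ≤ 1 * (‖x‖ * 1) := by
      rw [hv]
      gcongr
      exact ((SpatialTensor.toOp A C x).le_of_opNorm_le
        (NonUnitalStarAlgHom.norm_apply_le _ x) _).trans_eq (by rw [hv]; rfl)
    _ = ‖x‖ := by ring

/-- The value of the product state `σ ⊗ ν` at a fixed element depends weak*-continuously on `σ`. -/
lemma continuous_productState (ν : stateSpace C) (x : SpatialTensor A C) :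
    Continuous fun σ : stateSpace A => productState σ ν x := by
  refine continuous_of_uniform_approx_of_continuous fun U hU => ?_
  obtain ⟨ε, hε, hεU⟩ := Metric.mem_uniformity_dist.mp hU
  -- Contractivity of product states makes the error of replacing x by y less than ε uniformly in σ.
  obtain ⟨y, hy, hxy⟩ := (dense_span_tmul (A := A) (C := C)).exists_dist_lt x hε
  refine ⟨fun σ => productState σ ν y, ?_, fun σ => hεU ?_⟩
  · clear hxy
    induction hy using Submodule.span_induction with
    | mem z h =>
      obtain ⟨a, c, rfl⟩ := h
      simp only [productState_tmul]
      exact ((WeakDual.eval_continuous a).comp continuous_subtype_val).mul continuous_const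
    | zero => simpa only [map_zero] using continuous_const
    | add z z' _ _ h h' =>
      simp only [map_add]
      exact h.add h'
    | smul r z _ h =>
      simp only [map_smul, smul_eq_mul]
      exact continuous_const.mul h
  · rw [dist_eq_norm, ← map_sub]
    exact (norm_productState_apply_le _ _ _).trans_lt ((dist_eq_norm x y).symm.trans_lt hxy)

lemma RandomQuantumMap.continuous_transition (R : RandomQuantumMap A A C) :
    Continuous R.transition :=
  (WeakDual.continuous_of_continuous_eval fun a =>
    continuous_productState R.ν (R.φ a)).subtype_mk _

/-- The transition of a random quantum map preserves the linear relations between states. -/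
lemma RandomQuantumMap.transition_sum (R : RandomQuantumMap A A C) {ι : Type*} (s : Finset ι)
    (w : ι → ℝ) (σ : ι → stateSpace A) (ρ : stateSpace A)
    (h : (ρ : WeakDual ℂ A) = ∑ i ∈ s, w i • (σ i : WeakDual ℂ A)) :
    (R.transition ρ : WeakDual ℂ A) = ∑ i ∈ s, w i • (R.transition (σ i) : WeakDual ℂ A) := by
  have happly (τ : ι → WeakDual ℂ A) (a : A) : (∑ i ∈ s, w i • τ i) a = ∑ i ∈ s, w i • τ i a :=
    map_sum ((ContinuousLinearMap.apply ℂ ℂ a).toLinearMap.comp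
      WeakDual.toStrongDual.toLinearMap) _ _
  -- Both sides are continuous and agree on elementary tensors, so uniqueness of the product
  -- functional applies.
  have hω : (∑ i ∈ s, (w i : ℂ) • productState (σ i) R.ν) = productState ρ R.ν := by
    refine eq_productState _ _ _ fun a c => ?_
    rw [h, happly, Finset.sum_mul, sum_apply]
    refine Finset.sum_congr rfl fun i _ => ?_
    rw [smul_apply, productState_tmul, Complex.real_smul, smul_eq_mul,
      mul_assoc]
  refine ContinuousLinearMap.ext fun a => ?_
  refine Eq.trans ?_ (happly _ a).symm
  refine (RandomQuantumMap.transition_apply R ρ a).trans ?_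
  rw [← hω, sum_apply]
  refine Finset.sum_congr rfl fun i _ => ?_
  rw [smul_apply, Complex.real_smul, smul_eq_mul, transition_apply]

/-! ### The set of invariant states. -/

lemma RandomQuantumMap.invariantStates_subset (R : RandomQuantumMap A A C) :
    R.invariantStates ⊆ stateSpace A :=
  fun _ h => h.1

/-- The fixed points of a continuous self-map of a Hausdorff space are closed, and the state space
is itself closed in the dual. -/
lemma RandomQuantumMap.isClosed_invariantStates (R : RandomQuantumMap A A C) :
    IsClosed R.invariantStates := by
  have h : R.invariantStates = Subtype.val '' {σ : stateSpace A | R.transition σ = σ} := by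
    ext σ
    simp [invariantStates]
  rw [h]
  exact isClosed_stateSpace.isClosedEmbedding_subtypeVal.isClosedMap _
    (isClosed_eq R.continuous_transition continuous_id)

lemma RandomQuantumMap.convex_invariantStates (R : RandomQuantumMap A A C) :
    Convex ℝ R.invariantStates := by
  rintro σ ⟨hσ, hσ'⟩ τ ⟨hτ, hτ'⟩ s t hs ht hst
  refine ⟨convex_stateSpace hσ hτ hs ht hst, Subtype.ext ?_⟩
  rw [R.transition_sum Finset.univ ![s, t] ![⟨σ, hσ⟩, ⟨τ, hτ⟩] _ (by simp [Fin.sum_univ_two])]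
  simp [Fin.sum_univ_two, hσ', hτ']

/-- The averages of an orbit of the transition accumulate at an invariant state. -/
lemma RandomQuantumMap.invariantStates_nonempty [Nontrivial A] (R : RandomQuantumMap A A C) :
    R.invariantStates.Nonempty := by
  obtain ⟨σ₀, hσ₀⟩ := stateSpace_nonempty (A := A)
  let orbit (k : ℕ) : stateSpace A := R.transition^[k] ⟨σ₀, hσ₀⟩
  have horbit (k : ℕ) : R.transition (orbit k) = orbit (k + 1) :=
    (Function.iterate_succ_apply' _ _ _).symm
  -- Averaging n + 1 points avoids division by zero at n = 0.
  let mean (n : ℕ) : stateSpace A :=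
    ⟨∑ k ∈ Finset.range (n + 1), ((n + 1 : ℝ)⁻¹) • (orbit k : WeakDual ℂ A),
      convex_stateSpace.sum_mem (fun _ _ => by positivity)
        (by simp [mul_inv_cancel₀ (Nat.cast_add_one_ne_zero (R := ℝ) n)])
        fun k _ => (orbit k).2⟩
  -- The transition shifts the orbit by one, so only the two end terms survive.
  have hmean (n : ℕ) : (R.transition (mean n) : WeakDual ℂ A) - mean n =
      ((n + 1 : ℝ)⁻¹) • ((orbit (n + 1) : WeakDual ℂ A) - orbit 0) := by
    rw [R.transition_sum (Finset.range (n + 1)) (fun _ => (n + 1 : ℝ)⁻¹) orbit (mean n) rfl,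
      ← Finset.smul_sum]
    change _ - ∑ k ∈ Finset.range (n + 1), ((n + 1 : ℝ)⁻¹) • (orbit k : WeakDual ℂ A) = _
    rw [← Finset.smul_sum, ← smul_sub, ← Finset.sum_sub_distrib]
    simp only [horbit]
    rw [Finset.sum_range_sub (fun k => (orbit k : WeakDual ℂ A))]
  have : CompactSpace (stateSpace A) := isCompact_iff_compactSpace.mp isCompact_stateSpace
  -- A cluster point suffices; the state space need not be metrizable, so no convergent subsequence
  -- is claimed.
  obtain ⟨ρ, -, hρ⟩ := isCompact_univ.exists_mapClusterPt (f := Filter.atTop) (u := mean) (by simp)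
  refine ⟨ρ, ρ.2, Subtype.ext (DFunLike.ext _ _ fun a => sub_eq_zero.mp ?_)⟩
  have hcont : Continuous fun σ : stateSpace A =>
      (R.transition σ : WeakDual ℂ A) a - (σ : WeakDual ℂ A) a :=
    ((WeakDual.eval_continuous a).comp (continuous_subtype_val.comp R.continuous_transition)).sub
      ((WeakDual.eval_continuous a).comp continuous_subtype_val)
  have hlim : Filter.Tendsto (fun n => (R.transition (mean n) : WeakDual ℂ A) a -
      (mean n : WeakDual ℂ A) a) Filter.atTop (nhds 0) := by
    refine squeeze_zero_norm (a := fun n : ℕ => 1 / ((n : ℝ) + 1) * (‖a‖ + ‖a‖)) (fun n => ?_) ?_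
    · have h := DFunLike.congr_fun (hmean n) a
      change _ - _ = ((n + 1 : ℝ)⁻¹) • ((orbit (n + 1) : WeakDual ℂ A) a -
        (orbit 0 : WeakDual ℂ A) a) at h
      rw [← one_div] at h
      refine (congrArg norm h).trans_le ?_
      rw [norm_smul, Real.norm_of_nonneg (by positivity)]
      gcongr
      exact (norm_sub_le _ _).trans
        (add_le_add (norm_state_apply_le _ a) (norm_state_apply_le _ a))
    · simpa using (tendsto_one_div_add_atTop_nhds_zero_nat (𝕜 := ℝ)).mul_const (‖a‖ + ‖a‖)
  -- By continuity the difference at ρ is a cluster point of a sequence tending to 0, hence equals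
  -- 0.
  exact eq_of_nhds_neBot (ClusterPt.mono (hρ.tendsto_comp hcont.continuousAt) hlim)

end Transition

end RandomQuantum

end

theorem mainTheorem7 {A : Type*} [CStarAlgebra A] [PartialOrder A] [StarOrderedRing A]
    [Nontrivial A] {C : Type*} [CStarAlgebra C] [PartialOrder C] [StarOrderedRing C]
    (R : RandomQuantum.RandomQuantumMap A A C) :
    R.invariantStates ⊆ RandomQuantum.stateSpace A ∧ R.invariantStates.Nonempty ∧
      IsClosed R.invariantStates ∧ Convex ℝ R.invariantStates :=
  ⟨R.invariantStates_subset, R.invariantStates_nonempty, R.isClosed_invariantStates,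
    R.convex_invariantStates⟩
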